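/- Let $a<b$, let $\ell\ge 0$ be an integer, and let $y:[a,b]\to\mathbb R^m$ solve $y'=f(t,y)$, $y(a)=y_a$, where $f$ is of class $C^{\ell+1}$ on an open set $U\subseteq\mathbb R\times\mathbb R^m$ that contains the graph $\{(t,y(t)):t\in[a,b]\}$. Consider the RIDC method with a forward Euler predictor and $\ell$ first-order corrections on level-dependent non-uniform grids $a=t^{[k]}_0<t^{[k]}_1<\dots<t^{[k]}_{N^{[k]}}=b$, $0\le k\le\ell$. Write $\Delta t^{[k]}_n=t^{[k]}_n-t^{[k]}_{n-1}$ and $\Delta t=\max_{k,n}\Delta t^{[k]}_n$. The predictor is $\eta^{[0]}_0=y_a$, $\eta^{[0]}_n=\Phi^{[0]}_n(\eta^{[0]}_{n-1})$ with $$\Phi^{[0]}_n(x)=x+\Delta t^{[0]}_n f(t^{[0]}_{n-1},x).$$ For $1\le k\le\ell$ and $1\le n\le N^{[k]}$ let $\mathcal T^{[k]}_n$ be a set of $k+1$ nodes of the level-$(k-1)$ grid with $\min\mathcal T^{[k]}_n\le t^{[k]}_{n-1}$ and $\max\mathcal T^{[k]}_n\ge t^{[k]}_n$. For $\tau\in\mathcal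 T^{[k]}_n$ let $L_\tau$ be the Lagrange basis polynomial of these nodes with $L_\tau(\tau)=1$, let $\eta^{[k-1]}(\tau)$ be the level-$(k-1)$ value at the node $\tau$, and put $\gamma_\tau=L_\tau(t^{[k]}_{n-1})$ and $\alpha_\tau=\int_{t^{[k]}_{n-1}}^{t^{[k]}_n}L_\tau(t)\,dt$. The corrector is $\eta^{[k]}_0=y_a$, $\eta^{[k]}_n=\Phi^{[k]}_n(\eta^{[k]}_{n-1})$ with $$\Phi^{[k]}_n(x)=x+\Delta t^{[k]}_n\Big(f(t^{[k]}_{n-1},x)-\sum_{\tau\in\mathcal T^{[k]}_n}\gamma_\tau f(\tau,\eta^{[k-1]}(\tau))\Big)+\sum_{\tau\in\mathcal T^{[k]}_n}\alpha_\tau f(\tau,\eta^{[k-1]}(\tau)).$$ Fix $\kappa$, and suppose that every stencil is $\kappa$-regular: its diameter is at most $\kappa\,\Delta t$ and at most $\kappa$ times the distance of any two of its distinct nodes. (This holds, with $\kappa=\ell\,\omega^{\ell}$ when $\ell\ge1$, if each stencil consists of consecutive nodes and the ratios of neighbouring step sizes on each level lie in $[1/\omega,\omega]$, where $\omega\ge1$.)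 Then the method has formal order of accuracy $O(\Delta t^{\ell+2})$, in the sense of the local error, with the corresponding accumulated error: there are constants $C$ and $\delta>0$, depending only on $a,b,f,U,y,\ell,\kappa$, such that for all such grids and stencils with $\Delta t\le\delta$, $$\big\|y(t^{[\ell]}_n)-\Phi^{[\ell]}_n\big(y(t^{[\ell]}_{n-1})\big)\big\|\le C\,\Delta t^{\ell+2}\qquad(1\le n\le N^{[\ell]}),$$ $$\big\|y(t^{[\ell]}_n)-\eta^{[\ell]}_n\big\|\le C\,(t^{[\ell]}_n-a)\,\Delta t^{\ell+1}\qquad(0\le n\le N^{[\ell]}).$$ In particular, the error after $n$ steps from the initial value is at most $Cn\,\Delta t^{\ell+2}$, and the global error on $[a,b]$ is $O(\Delta t^{\ell+1})$. -/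

import Mathlib

/-- The discretization data of a RIDC method with `L` corrections on `[a, b]`: for each level
`ℓ ≤ L` a grid `a = t ℓ 0 < t ℓ 1 < ⋯ < t ℓ (N ℓ) = b`, and, for each correction level `ℓ + 1 ≤ L`
and each step from `t (ℓ+1) n` to `t (ℓ+1) (n+1)`, a stencil of `(ℓ + 1) + 1` nodes of level `ℓ`
(given by their indices) whose smallest node is `≤ t (ℓ+1) n` and whose largest node is
`≥ t (ℓ+1) (n+1)`. Values at other arguments are irrelevant. -/
structure RIDCMesh (a b : ℝ) (L : ℕ) where
  N : ℕ → ℕ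
  t : ℕ → ℕ → ℝ
  t_zero : ∀ ℓ ≤ L, t ℓ 0 = a
  t_last : ∀ ℓ ≤ L, t ℓ (N ℓ) = b
  t_lt : ∀ ℓ ≤ L, ∀ n < N ℓ, t ℓ n < t ℓ (n + 1)
  stencil : ℕ → ℕ → Finset ℕ
  stencil_card : ∀ ℓ < L, ∀ n < N (ℓ + 1), (stencil (ℓ + 1) n).card = (ℓ + 1) + 1
  stencil_le : ∀ ℓ < L, ∀ n < N (ℓ + 1), ∀ i ∈ stencil (ℓ + 1) n, i ≤ N ℓ
  stencil_min : ∀ ℓ < L, ∀ n < N (ℓ + 1), ∃ i ∈ stencil (ℓ + 1) n, t ℓ i ≤ t (ℓ + 1) n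
  stencil_max : ∀ ℓ < L, ∀ n < N (ℓ + 1), ∃ i ∈ stencil (ℓ + 1) n, t (ℓ + 1) (n + 1) ≤ t ℓ i

namespace RIDCMesh

variable {a b : ℝ} {L : ℕ}

/-- The length of the step from node `n` to node `n + 1` on level `ℓ`. -/
def stepSize (G : RIDCMesh a b L) (ℓ n : ℕ) : ℝ := G.t ℓ (n + 1) - G.t ℓ n

/-- The largest step over all levels `0, …, L` and all steps. -/
noncomputable def maxStep (G : RIDCMesh a b L) : ℝ :=
  ⨆ (ℓ : Fin (L + 1)) (n : Fin (G.N ℓ)), G.stepSize ℓ n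

/-- Uniform regularity of the stencils: the diameter of every stencil is at most `κ` times the
maximal step, and at most `κ` times the distance of any two distinct nodes of that stencil. -/
def StencilRegular (G : RIDCMesh a b L) (κ : ℝ) : Prop :=
  ∀ ℓ < L, ∀ n < G.N (ℓ + 1), ∀ i ∈ G.stencil (ℓ + 1) n, ∀ j ∈ G.stencil (ℓ + 1) n,
    |G.t ℓ i - G.t ℓ j| ≤ κ * G.maxStep ∧
    ∀ k ∈ G.stencil (ℓ + 1) n, ∀ l ∈ G.stencil (ℓ + 1) n, k ≠ l →
      |G.t ℓ i - G.t ℓ j| ≤ κ * |G.t ℓ k - G.t ℓ l|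

/-- The quadrature weight of the stencil node `i` on level `ℓ`, for step `n` of level `ℓ + 1`: the
exact integral over that step of the Lagrange basis polynomial. -/
noncomputable def quadWeight (G : RIDCMesh a b L) (ℓ n i : ℕ) : ℝ :=
  ∫ s in (G.t (ℓ + 1) n)..(G.t (ℓ + 1) (n + 1)),
    (Lagrange.basis (G.stencil (ℓ + 1) n) (G.t ℓ) i).eval s

/-- The interpolation weight of the stencil node `i` on level `ℓ`, for step `n` of level `ℓ + 1`:
the value of the Lagrange basis polynomial at the left end of that step. -/
noncomputable def interpWeight (G : RIDCMesh a b L) (ℓ n i : ℕ) : ℝ :=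
  (Lagrange.basis (G.stencil (ℓ + 1) n) (G.t ℓ) i).eval (G.t (ℓ + 1) n)

variable {E : Type*} [AddCommGroup E] [Module ℝ E]

/-- One forward Euler step of the predictor, started from `x` at the node `n` of level `0`. -/
def predictorStep (G : RIDCMesh a b L) (f : ℝ → E → E) (n : ℕ) (x : E) : E :=
  x + G.stepSize 0 n • f (G.t 0 n) x

/-- One step of the first-order corrector of level `ℓ + 1`, started from `x` at the node `n` of
that level, where `prev` is the discrete solution on level `ℓ`. -/
noncomputable def correctorStep (G : RIDCMesh a b L) (f : ℝ → E → E) (ℓ : ℕ) (prev : ℕ → E)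
    (n : ℕ) (x : E) : E :=
  x + G.stepSize (ℓ + 1) n •
      (f (G.t (ℓ + 1) n) x -
        ∑ i ∈ G.stencil (ℓ + 1) n, G.interpWeight ℓ n i • f (G.t ℓ i) (prev i))
    + ∑ i ∈ G.stencil (ℓ + 1) n, G.quadWeight ℓ n i • f (G.t ℓ i) (prev i)

/-- The discrete RIDC solution: `G.solution f ya ℓ n` is the approximation at the node `n` of
level `ℓ`. Level `0` is the predictor, and level `ℓ + 1` corrects level `ℓ`. -/
noncomputable def solution (G : RIDCMesh a b L) (f : ℝ → E → E) (ya : E) : ℕ → ℕ → E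
  | 0 => fun n => Nat.rec ya (fun k x => G.predictorStep f k x) n
  | ℓ + 1 => fun n => Nat.rec ya (fun k x => G.correctorStep f ℓ (solution G f ya ℓ) k x) n

/-- One step of level `ℓ` of the method, started from an arbitrary value `x` at the node `n` of that
level, where the lower level is the one computed by the method. -/
noncomputable def stepMap (G : RIDCMesh a b L) (f : ℝ → E → E) (ya : E) : ℕ → ℕ → E → E
  | 0 => G.predictorStep f
  | ℓ + 1 => G.correctorStep f ℓ (G.solution f ya ℓ)

theorem solution_zero (G : RIDCMesh a b L) (f : ℝ → E → E) (ya : E) (ℓ : ℕ) :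
    G.solution f ya ℓ 0 = ya := by
  cases ℓ <;> rfl

theorem solution_succ (G : RIDCMesh a b L) (f : ℝ → E → E) (ya : E) (ℓ n : ℕ) :
    G.solution f ya ℓ (n + 1) = G.stepMap f ya ℓ n (G.solution f ya ℓ n) := by
  cases ℓ <;> rfl

end RIDCMesh

/-! Induction on the level `k`, carrying not only the size of the error but also its Lipschitz
constant in the node: both are `O(Δt ^ (k + 1))`. The increments are what makes a correction gain an
order on arbitrary non-uniform grids.

Put `g s = f s (y s)` and let `Q` be the interpolant of `f` along the level-`k` solution. The defect
of a corrector step is the integral over that step of `(g - Q) s - (g - Q) tₙ` (`localError_succ`).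
Write `g - Q` as the interpolation error of `g` plus the interpolant of the data `e i = f (tᵢ, y tᵢ)
- f (tᵢ, ηᵢ)`. The former is `O(Δt ^ (k + 2))`, as there are `k + 2` regular nodes
(`norm_sub_interp_le`). The data `e` is Lipschitz with constant `O(Δt ^ (k + 1))`, and regular nodes
pass this on to the interpolant (`norm_interp_sub_le`), so its difference across one step is again
`O(Δt ^ (k + 2))`. Integration supplies the remaining factor, the step length.

At every level the step depends on its starting value as an Euler step does, so discrete Gronwall
turns local errors into accumulated ones (`norm_error_le`), and the error recursion then bounds the
increments (`norm_error_sub_le`), closing the induction. -/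

/-! ### Lagrange interpolation on regular nodes. -/

theorem abs_prod_sub_prod_le {ι : Type*} (s : Finset ι) (u w : ι → ℝ) {K θ : ℝ} (hK : 0 ≤ K)
    (hu : ∀ j ∈ s, |u j| ≤ K) (hw : ∀ j ∈ s, |w j| ≤ K) (huw : ∀ j ∈ s, |u j - w j| ≤ K * θ) :
    |∏ j ∈ s, u j - ∏ j ∈ s, w j| ≤ s.card * K ^ s.card * θ := by
  classical
  induction s using Finset.induction_on with
  | empty => simp
  | insert i s hi ih =>
    simp only [Finset.mem_insert, forall_eq_or_imp] at hu hw huw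
    rw [Finset.prod_insert hi, Finset.prod_insert hi, Finset.card_insert_of_notMem hi]
    have h1 := ih hu.2 hw.2 huw.2
    have h2 : |∏ j ∈ s, u j| ≤ K ^ s.card := by
      rw [Finset.abs_prod, ← Finset.prod_const]
      exact Finset.prod_le_prod (fun _ _ => abs_nonneg _) hu.2
    calc |u i * ∏ j ∈ s, u j - w i * ∏ j ∈ s, w j|
        = |(u i - w i) * ∏ j ∈ s, u j + w i * (∏ j ∈ s, u j - ∏ j ∈ s, w j)| := by ring_nf
      _ ≤ |u i - w i| * |∏ j ∈ s, u j| + |w i| * |∏ j ∈ s, u j - ∏ j ∈ s, w j| := by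
        rw [← abs_mul, ← abs_mul]; exact abs_add_le _ _
      _ ≤ (K * θ) * K ^ s.card + K * (s.card * K ^ s.card * θ) := by
        have h0 := (abs_nonneg _).trans huw.1
        gcongr
        · exact huw.1
        · exact hw.1
      _ = _ := by push_cast; ring

/-- The nodes `v i`, `i ∈ s`, form a `κ`-regular stencil of diameter at most `M`, up to which
distance the points `x` of interest lie from the nodes. -/
structure RegularNodes (s : Finset ℕ) (v : ℕ → ℝ) (κ M : ℝ) : Prop where
  pos : 0 < M
  kappa_nonneg : 0 ≤ κ
  sep : ∀ k ∈ s, ∀ l ∈ s, k ≠ l → M ≤ κ * |v k - v l|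
  diam : ∀ k ∈ s, ∀ l ∈ s, |v k - v l| ≤ M

namespace RegularNodes

variable {s : Finset ℕ} {v : ℕ → ℝ} {κ M : ℝ}

theorem ne (h : RegularNodes s v κ M) {k l : ℕ} (hk : k ∈ s) (hl : l ∈ s) (hkl : k ≠ l) :
    v k ≠ v l := by
  intro e
  have := h.sep k hk l hl hkl
  rw [e, sub_self, abs_zero, mul_zero] at this
  exact absurd h.pos this.not_gt

theorem injOn (h : RegularNodes s v κ M) : Set.InjOn v s := by
  intro k hk l hl e
  by_contra hkl
  exact h.ne hk hl hkl e

theorem eval_basis (i : ℕ) (x : ℝ) :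
    (Lagrange.basis s v i).eval x = ∏ j ∈ s.erase i, (v i - v j)⁻¹ * (x - v j) := by
  simp [Lagrange.basis, Lagrange.basisDivisor, Polynomial.eval_prod]

theorem abs_inv_mul_le (h : RegularNodes s v κ M) {i j : ℕ} (hi : i ∈ s) (hj : j ∈ s.erase i)
    {z c : ℝ} (hz : |z| ≤ M * c) : |(v i - v j)⁻¹ * z| ≤ κ * c := by
  obtain ⟨hji, hj⟩ := Finset.mem_erase.1 hj
  have hpos : 0 < |v i - v j| := abs_pos.2 (sub_ne_zero.2 (h.ne hi hj hji.symm))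
  have hc : 0 ≤ c := by
    have := (abs_nonneg z).trans hz
    exact nonneg_of_mul_nonneg_right this h.pos
  rw [abs_mul, abs_inv, inv_mul_le_iff₀ hpos]
  calc |z| ≤ M * c := hz
    _ ≤ (κ * |v i - v j|) * c := by gcongr; exact h.sep i hi j hj hji.symm
    _ = _ := by ring

theorem abs_eval_basis_le (h : RegularNodes s v κ M) {p i : ℕ} (hs : s.card = p + 1) (hi : i ∈ s)
    {x : ℝ} (hx : ∀ j ∈ s, |x - v j| ≤ M) : |(Lagrange.basis s v i).eval x| ≤ κ ^ p := by
  rw [eval_basis, Finset.abs_prod]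
  have hc : (s.erase i).card = p := by rw [Finset.card_erase_of_mem hi, hs]; rfl
  rw [← hc, ← Finset.prod_const]
  refine Finset.prod_le_prod (fun _ _ => abs_nonneg _) fun j hj => ?_
  simpa using h.abs_inv_mul_le hi hj (c := 1) (by simpa using hx j (Finset.mem_of_mem_erase hj))

/-- Each of the `p` linear factors is at most `κ` and changes by at most `κ * |x - x'| / M`; replace
them one at a time. -/
theorem abs_eval_basis_sub_le (h : RegularNodes s v κ M) {p i : ℕ} (hs : s.card = p + 1)
    (hi : i ∈ s) {x x' : ℝ} (hx : ∀ j ∈ s, |x - v j| ≤ M) (hx' : ∀ j ∈ s, |x' - v j| ≤ M) :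
    |(Lagrange.basis s v i).eval x - (Lagrange.basis s v i).eval x'| ≤
      p * κ ^ p * (|x - x'| / M) := by
  rw [eval_basis, eval_basis]
  have hc : (s.erase i).card = p := by rw [Finset.card_erase_of_mem hi, hs]; rfl
  rw [← hc]
  refine abs_prod_sub_prod_le _ _ _ h.kappa_nonneg (fun j hj => ?_) (fun j hj => ?_) fun j hj => ?_
  · simpa using h.abs_inv_mul_le hi hj (c := 1) (by simpa using hx j (Finset.mem_of_mem_erase hj))
  · simpa using h.abs_inv_mul_le hi hj (c := 1) (by simpa using hx' j (Finset.mem_of_mem_erase hj))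
  · rw [← mul_sub, sub_sub_sub_cancel_right]
    exact h.abs_inv_mul_le hi hj (by rw [mul_div_cancel₀ _ h.pos.ne'])

theorem sum_eval_basis (h : RegularNodes s v κ M) (hs : s.Nonempty) (x : ℝ) :
    ∑ i ∈ s, (Lagrange.basis s v i).eval x = 1 := by
  rw [← Polynomial.eval_finsetSum, Lagrange.sum_basis h.injOn hs, Polynomial.eval_one]

variable {E : Type*} [NormedAddCommGroup E] [NormedSpace ℝ E]

/-- Interpolation of Lipschitz data on regular nodes is Lipschitz. -/
theorem norm_interp_sub_le (h : RegularNodes s v κ M) {p : ℕ} (hs : s.card = p + 1)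
    {x x' B : ℝ} (hx : ∀ j ∈ s, |x - v j| ≤ M) (hx' : ∀ j ∈ s, |x' - v j| ≤ M)
    {e : ℕ → E} (hB : 0 ≤ B) (he : ∀ i ∈ s, ∀ j ∈ s, ‖e i - e j‖ ≤ B * |v i - v j|) :
    ‖∑ i ∈ s, (Lagrange.basis s v i).eval x • e i - ∑ i ∈ s, (Lagrange.basis s v i).eval x' • e i‖
      ≤ (p + 1) * p * κ ^ p * B * |x - x'| := by
  have hne : s.Nonempty := Finset.card_pos.1 (by omega)
  obtain ⟨i₀, hi₀⟩ := hne
  -- The weights sum to one at both points, so a constant may be subtracted from the data. The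
  -- remaining `e i - e i₀` is at most `B * M`, which cancels the `1 / M` in the variation of the
  -- basis.
  have key : ∑ i ∈ s, (Lagrange.basis s v i).eval x • e i
      - ∑ i ∈ s, (Lagrange.basis s v i).eval x' • e i =
      ∑ i ∈ s, ((Lagrange.basis s v i).eval x - (Lagrange.basis s v i).eval x') •
        (e i - e i₀) := by
    simp only [smul_sub, sub_smul, Finset.sum_sub_distrib, ← Finset.sum_smul,
      h.sum_eval_basis ⟨i₀, hi₀⟩]
    abel
  rw [key]
  calc _ ≤ ∑ i ∈ s, (p * κ ^ p * (|x - x'| / M)) * (B * M) := by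
        refine norm_sum_le_of_le _ fun i hi => ?_
        rw [norm_smul, Real.norm_eq_abs]
        have h1 := h.abs_eval_basis_sub_le hs hi hx hx'
        refine mul_le_mul h1 ((he i hi i₀ hi₀).trans ?_) (norm_nonneg _) ((abs_nonneg _).trans h1)
        gcongr
        exact h.diam i hi i₀ hi₀
    _ = _ := by
        have := h.pos.ne'
        rw [Finset.sum_const, hs, nsmul_eq_mul]
        push_cast
        field_simp

theorem sum_eval_basis_smul_pow (h : RegularNodes s v κ M) {k : ℕ} (hk : k < s.card) (c x : ℝ) :
    ∑ i ∈ s, (Lagrange.basis s v i).eval x * (v i - c) ^ k = (x - c) ^ k := by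
  have hd : ((Polynomial.X - Polynomial.C c) ^ k : Polynomial ℝ).degree < s.card := by
    rw [Polynomial.degree_pow, Polynomial.degree_X_sub_C]
    simpa using hk
  have := congrArg (Polynomial.eval x) (Lagrange.eq_interpolate h.injOn hd)
  simp only [Lagrange.interpolate_apply, Polynomial.eval_finsetSum, Polynomial.eval_mul,
    Polynomial.eval_C, Polynomial.eval_pow, Polynomial.eval_sub, Polynomial.eval_X] at this
  rw [this]
  exact Finset.sum_congr rfl fun i _ => mul_comm _ _

/-- The error of polynomial interpolation of a smooth function on regular nodes. -/
theorem norm_sub_interp_le (h : RegularNodes s v κ M) {p : ℕ} (hs : s.card = p + 1)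
    {a b R x : ℝ} {g : ℝ → E} (hab : a < b) (hg : ContDiffOn ℝ (p + 1) g (Set.Icc a b))
    (hR : ∀ z ∈ Set.Icc a b, ‖iteratedDerivWithin (p + 1) g (Set.Icc a b) z‖ ≤ R)
    (hv : ∀ i ∈ s, v i ∈ Set.Icc a b) (hxb : x ∈ Set.Icc a b)
    (hx : ∀ j ∈ s, |x - v j| ≤ M) (hmin : ∃ i ∈ s, v i ≤ x) (hmax : ∃ i ∈ s, v i < b) :
    ‖g x - ∑ i ∈ s, (Lagrange.basis s v i).eval x • g (v i)‖ ≤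
      (1 + (p + 1) * κ ^ p) * R * M ^ (p + 1) := by
  have hne : s.Nonempty := Finset.card_pos.1 (by omega)
  obtain ⟨i₀, hi₀, hi₀min⟩ := Finset.exists_min_image s v hne
  -- Taylor expansion is at the leftmost node, on `[c, b]`, because the remainder bound used expands
  -- at the left endpoint; all nodes and `x` lie to its right.
  set c := v i₀ with hc
  have hcb : c < b := by
    obtain ⟨i, hi, hib⟩ := hmax
    exact (hi₀min i hi).trans_lt hib
  have hcx : c ≤ x := by
    obtain ⟨i, hi, hix⟩ := hmin
    exact (hi₀min i hi).trans hix
  have hsub : Set.Icc c b ⊆ Set.Icc a b := Set.Icc_subset_Icc_left (hv i₀ hi₀).1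
  have hR0 : 0 ≤ R := (norm_nonneg _).trans (hR x hxb)
  have htay : ∀ z ∈ Set.Icc c b, |z - c| ≤ M →
      ‖g z - taylorWithinEval g p (Set.Icc c b) c z‖ ≤ R * M ^ (p + 1) := by
    intro z hz hzM
    have hd : ∀ w ∈ Set.Icc c b, ‖iteratedDerivWithin (p + 1) g (Set.Icc c b) w‖ ≤ R := by
      intro w hw
      have : iteratedDerivWithin (p + 1) g (Set.Icc c b) w =
          iteratedDerivWithin (p + 1) g (Set.Icc a b) w := by
        rw [iteratedDerivWithin, iteratedDerivWithin, iteratedFDerivWithin_subset hsub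
          (uniqueDiffOn_Icc hcb) (uniqueDiffOn_Icc hab) (by exact_mod_cast hg) hw]
      rw [this]
      exact hR w (hsub hw)
    refine (taylor_mean_remainder_bound hcb.le (hg.mono hsub) hz hd).trans ?_
    have h1 : (1 : ℝ) ≤ (p.factorial : ℝ) := by exact_mod_cast Nat.one_le_iff_ne_zero.2 p.factorial_ne_zero
    have h2 : 0 ≤ z - c := sub_nonneg.2 hz.1
    refine (div_le_self (by positivity) h1).trans ?_
    gcongr
    exact (le_abs_self _).trans hzM
  -- Interpolation on `p + 1` nodes reproduces the Taylor polynomial, so only remainders contribute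
  -- to the error.
  have hrep : ∑ i ∈ s, (Lagrange.basis s v i).eval x • taylorWithinEval g p (Set.Icc c b) c (v i) =
      taylorWithinEval g p (Set.Icc c b) c x := by
    simp only [taylor_within_apply, Finset.smul_sum]
    rw [Finset.sum_comm]
    refine Finset.sum_congr rfl fun k hk => ?_
    rw [← h.sum_eval_basis_smul_pow (k := k) (by rw [hs]; exact Finset.mem_range.1 hk) c x,
      Finset.mul_sum, Finset.sum_smul]
    refine Finset.sum_congr rfl fun i _ => ?_
    rw [smul_smul]
    congr 1
    ring
  have hx0 := htay x ⟨hcx, hxb.2⟩ (hx i₀ hi₀)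
  have key : g x - ∑ i ∈ s, (Lagrange.basis s v i).eval x • g (v i) =
      (g x - taylorWithinEval g p (Set.Icc c b) c x) -
      ∑ i ∈ s, (Lagrange.basis s v i).eval x •
        (g (v i) - taylorWithinEval g p (Set.Icc c b) c (v i)) := by
    simp only [smul_sub, Finset.sum_sub_distrib, hrep]
    abel
  rw [key]
  refine (norm_sub_le _ _).trans ?_
  have hsum : ‖∑ i ∈ s, (Lagrange.basis s v i).eval x •
        (g (v i) - taylorWithinEval g p (Set.Icc c b) c (v i))‖ ≤
      ∑ i ∈ s, κ ^ p * (R * M ^ (p + 1)) := by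
    refine norm_sum_le_of_le _ fun i hi => ?_
    rw [norm_smul, Real.norm_eq_abs]
    have hκ := h.kappa_nonneg
    gcongr
    · exact h.abs_eval_basis_le hs hi hx
    · exact htay (v i) ⟨hi₀min i hi, (hv i hi).2⟩ (h.diam i hi i₀ hi₀)
  rw [Finset.sum_const, hs, nsmul_eq_mul] at hsum
  push_cast at hsum
  calc _ ≤ _ := add_le_add hx0 hsum
    _ = _ := by ring

end RegularNodes

/-! ### Bounds for `f` on a compact tube around the solution. -/

section Tube

variable {E : Type*} [NormedAddCommGroup E] {f : ℝ → E → E} {y : ℝ → E} {U : Set (ℝ × E)} {a b : ℝ}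

theorem exists_tube_subset (hU : IsOpen U) (hyc : ContinuousOn y (Set.Icc a b))
    (hyU : ∀ s ∈ Set.Icc a b, (s, y s) ∈ U) :
    ∃ r : ℝ, 0 < r ∧ ∀ s ∈ Set.Icc a b, ∀ d : E, ‖d‖ ≤ r → (s, y s - d) ∈ U := by
  have hK : IsCompact ((fun s => (s, y s)) '' Set.Icc a b) :=
    isCompact_Icc.image_of_continuousOn (continuousOn_id.prodMk hyc)
  obtain ⟨r, hr, hrU⟩ := hK.exists_cthickening_subset_open hU (by
    rintro _ ⟨s, hs, rfl⟩
    exact hyU s hs)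
  refine ⟨r, hr, fun s hs d hd => hrU ?_⟩
  refine Metric.mem_cthickening_of_dist_le _ (s, y s) _ _ ⟨s, hs, rfl⟩ ?_
  simp [dist_eq_norm, hd]

theorem exists_bound_on_tube [ProperSpace E] {F : Type*} [SeminormedAddCommGroup F]
    {φ : ℝ × E → F} (hφ : ContinuousOn φ U) (hyc : ContinuousOn y (Set.Icc a b)) {r : ℝ}
    (hr : ∀ s ∈ Set.Icc a b, ∀ d : E, ‖d‖ ≤ r → (s, y s - d) ∈ U) :
    ∃ C : ℝ, 0 ≤ C ∧ ∀ s ∈ Set.Icc a b, ∀ d : E, ‖d‖ ≤ r → ‖φ (s, y s - d)‖ ≤ C := by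
  have hcont : ContinuousOn (fun p : ℝ × E => φ (p.1, y p.1 - p.2))
      (Set.Icc a b ×ˢ Metric.closedBall 0 r) := by
    refine hφ.comp (continuousOn_fst.prodMk ((hyc.comp continuousOn_fst fun p hp => hp.1).sub
      continuousOn_snd)) fun p hp => hr p.1 hp.1 p.2 (by simpa using hp.2)
  obtain ⟨C, hC⟩ := (isCompact_Icc.prod (isCompact_closedBall (0 : E) r)).exists_bound_of_continuousOn
    hcont
  exact ⟨max C 0, le_max_right _ _, fun s hs d hd =>
    (hC (s, d) ⟨hs, by simpa using hd⟩).trans (le_max_left _ _)⟩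

variable [NormedSpace ℝ E]

/-- Solutions of an ODE with a right-hand side of class `C^n` are of class `C^(n+1)`; stated for
the derivative. -/
theorem contDiffOn_rhs_of_hasDerivWithinAt (hab : a < b) {n : ℕ}
    (hf : ContDiffOn ℝ n (Function.uncurry f) U) (hyU : ∀ s ∈ Set.Icc a b, (s, y s) ∈ U)
    (hy : ∀ s ∈ Set.Icc a b, HasDerivWithinAt y (f s (y s)) (Set.Icc a b) s) :
    ContDiffOn ℝ n (fun s => f s (y s)) (Set.Icc a b) := by
  have hcomp : ∀ k : ℕ, k ≤ n → ContDiffOn ℝ k y (Set.Icc a b) →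
      ContDiffOn ℝ k (fun s => f s (y s)) (Set.Icc a b) := fun k hk hyk =>
    (hf.of_le (by exact_mod_cast hk)).comp (contDiffOn_id.prodMk hyk) fun s hs => hyU s hs
  have hyk : ∀ k : ℕ, k ≤ n → ContDiffOn ℝ k y (Set.Icc a b) := by
    intro k
    induction k with
    | zero =>
      intro _
      exact contDiffOn_zero.2 fun s hs => (hy s hs).continuousWithinAt
    | succ k ih =>
      intro hk
      have hud := uniqueDiffOn_Icc hab
      push_cast
      refine (contDiffOn_succ_iff_derivWithin hud).2
        ⟨fun s hs => (hy s hs).differentiableWithinAt, by simp, ?_⟩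
      exact (hcomp k (by omega) (ih (by omega))).congr fun s hs => (hy s hs).derivWithin (hud s hs)
  exact hcomp n le_rfl (hyk n le_rfl)

theorem hasFDerivAt_slice (hU : IsOpen U) (hf : DifferentiableOn ℝ (Function.uncurry f) U)
    {s : ℝ} {d : E} (hd : (s, y s - d) ∈ U) :
    HasFDerivAt (fun d => f s (y s - d))
      (-(fderiv ℝ (Function.uncurry f) (s, y s - d)).comp (ContinuousLinearMap.inr ℝ ℝ E)) d := by
  have h1 : HasFDerivAt (fun d => (s, y s - d)) (-ContinuousLinearMap.inr ℝ ℝ E) d := by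
    have := (hasFDerivAt_const (𝕜 := ℝ) s d).prodMk ((hasFDerivAt_id (𝕜 := ℝ) d).const_sub (y s))
    exact this.congr_fderiv (ContinuousLinearMap.ext fun z => by simp)
  have h2 := ((hf.differentiableAt (hU.mem_nhds hd)).hasFDerivAt).comp d h1
  rw [ContinuousLinearMap.comp_neg] at h2
  exact h2

theorem norm_neg_comp_inr_le (T : ℝ × E →L[ℝ] E) :
    ‖-T.comp (ContinuousLinearMap.inr ℝ ℝ E)‖ ≤ ‖T‖ := by
  rw [norm_neg]
  refine (ContinuousLinearMap.opNorm_comp_le _ _).trans ?_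
  exact mul_le_of_le_one_right (norm_nonneg _) (ContinuousLinearMap.norm_inr_le_one ..)

/-- The mean value inequality is applied in `d` alone, on a ball, so convexity of `U` is not needed.
-/
theorem exists_lipschitz_on_tube [ProperSpace E] (hU : IsOpen U)
    (hf : ContDiffOn ℝ 1 (Function.uncurry f) U) (hyc : ContinuousOn y (Set.Icc a b)) {r : ℝ}
    (hr : ∀ s ∈ Set.Icc a b, ∀ d : E, ‖d‖ ≤ r → (s, y s - d) ∈ U) :
    ∃ Λ : ℝ, 0 ≤ Λ ∧ ∀ s ∈ Set.Icc a b, ∀ d d' : E, ‖d‖ ≤ r → ‖d'‖ ≤ r →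
      ‖f s (y s - d) - f s (y s - d')‖ ≤ Λ * ‖d - d'‖ := by
  obtain ⟨Λ, hΛ, hb⟩ := exists_bound_on_tube (hf.continuousOn_fderiv_of_isOpen hU le_rfl) hyc hr
  refine ⟨Λ, hΛ, fun s hs d d' hd hd' => ?_⟩
  refine (convex_closedBall (0 : E) r).norm_image_sub_le_of_norm_hasFDerivWithin_le
    (f := fun d => f s (y s - d)) (fun x hx => (hasFDerivAt_slice hU
      (hf.differentiableOn one_ne_zero) (hr s hs x (by simpa using hx))).hasFDerivWithinAt)
    (fun x hx => (norm_neg_comp_inr_le _).trans (hb s hs x (by simpa using hx)))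
    (by simpa using hd') (by simpa using hd)

/-- A mixed second difference, vanishing at `d = 0`. Its derivative in `d` is a difference of
derivatives of `f` along `s ↦ (s, y s - d)`, a curve with velocity `(1, f s (y s))`; the mean value
inequality is used once in `s` and once in `d`. -/
theorem exists_lipschitz_increment_on_tube [ProperSpace E] (hU : IsOpen U)
    (hf : ContDiffOn ℝ 2 (Function.uncurry f) U)
    (hy : ∀ s ∈ Set.Icc a b, HasDerivWithinAt y (f s (y s)) (Set.Icc a b) s) {r : ℝ}
    (hr0 : 0 ≤ r)
    (hr : ∀ s ∈ Set.Icc a b, ∀ d : E, ‖d‖ ≤ r → (s, y s - d) ∈ U) :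
    ∃ C : ℝ, 0 ≤ C ∧ ∀ s ∈ Set.Icc a b, ∀ s' ∈ Set.Icc a b, ∀ d : E, ‖d‖ ≤ r →
      ‖(f s (y s) - f s (y s - d)) - (f s' (y s') - f s' (y s' - d))‖ ≤ C * |s - s'| * ‖d‖ := by
  have hyc : ContinuousOn y (Set.Icc a b) := fun s hs => (hy s hs).continuousWithinAt
  have hD : ContDiffOn ℝ 1 (fderiv ℝ (Function.uncurry f)) U :=
    hf.fderiv_of_isOpen hU (by norm_num)
  obtain ⟨C₁, hC₁, hb₁⟩ := exists_bound_on_tube (hD.continuousOn_fderiv_of_isOpen hU le_rfl) hyc hr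
  obtain ⟨C₂, hC₂, hb₂⟩ := exists_bound_on_tube hf.continuousOn hyc hr
  have hlip : ∀ s ∈ Set.Icc a b, ∀ s' ∈ Set.Icc a b, ∀ d : E, ‖d‖ ≤ r →
      ‖fderiv ℝ (Function.uncurry f) (s, y s - d) - fderiv ℝ (Function.uncurry f) (s', y s' - d)‖
        ≤ C₁ * max 1 C₂ * |s - s'| := by
    intro s hs s' hs' d hd
    refine (convex_Icc a b).norm_image_sub_le_of_norm_hasDerivWithin_le
      (f := fun s => fderiv ℝ (Function.uncurry f) (s, y s - d))
      (f' := fun s => fderiv ℝ (fderiv ℝ (Function.uncurry f)) (s, y s - d) (1, f s (y s)))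
      (fun x hx => ?_) (fun x hx => ?_) hs' hs
    · have h1 : HasDerivWithinAt (fun s => (s, y s - d)) (1, f x (y x)) (Set.Icc a b) x :=
        (hasDerivWithinAt_id x _).prodMk ((hy x hx).sub_const d)
      have h2 := ((hD.differentiableOn one_ne_zero).differentiableAt
        (hU.mem_nhds (hr x hx d hd))).hasFDerivAt
      exact h2.comp_hasDerivWithinAt x h1
    · refine (ContinuousLinearMap.le_opNorm _ _).trans ?_
      refine mul_le_mul (hb₁ x hx d hd) ?_ (norm_nonneg _) hC₁
      rw [Prod.norm_def]
      have := hb₂ x hx 0 (by simpa using hr0)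
      simp only [sub_zero, Function.uncurry_apply_pair] at this
      exact max_le_max (by simp) this
  refine ⟨C₁ * max 1 C₂, by positivity, fun s hs s' hs' d hd => ?_⟩
  have hdiff := hf.differentiableOn two_ne_zero
  have := (convex_closedBall (0 : E) r).norm_image_sub_le_of_norm_hasFDerivWithin_le
    (f := fun d => f s (y s - d) - f s' (y s' - d)) (x := d) (y := 0)
    (C := C₁ * max 1 C₂ * |s - s'|)
    (fun x hx => ((hasFDerivAt_slice hU hdiff (hr s hs x (by simpa using hx))).sub
      (hasFDerivAt_slice hU hdiff (hr s' hs' x (by simpa using hx)))).hasFDerivWithinAt)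
    (fun x hx => ?_) (by simpa using hd) (by simpa using hr0)
  · simp only [sub_zero, zero_sub, norm_neg] at this
    convert this using 2
    abel
  · rw [neg_sub_neg, ← ContinuousLinearMap.sub_comp, ← norm_neg]
    refine (norm_neg_comp_inr_le _).trans ?_
    rw [norm_sub_rev]
    exact hlip s hs s' hs' x (by simpa using hx)

end Tube

namespace RIDCMesh

/-! ### Grids and stencils. -/

section Grid

variable {a b : ℝ} {L : ℕ} (G : RIDCMesh a b L)

theorem t_mono {k : ℕ} (hk : k ≤ L) {i j : ℕ} (hij : i ≤ j) (hj : j ≤ G.N k) :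
    G.t k i ≤ G.t k j := by
  induction j, hij using Nat.le_induction with
  | base => exact le_rfl
  | succ j _ ih => exact (ih (by omega)).trans (G.t_lt k hk j (by omega)).le

theorem t_strictMono {k : ℕ} (hk : k ≤ L) {i j : ℕ} (hij : i < j) (hj : j ≤ G.N k) :
    G.t k i < G.t k j :=
  (G.t_lt k hk i (by omega)).trans_le (G.t_mono hk hij hj)

theorem t_mem_Icc {k : ℕ} (hk : k ≤ L) {i : ℕ} (hi : i ≤ G.N k) : G.t k i ∈ Set.Icc a b := by
  constructor
  · simpa [G.t_zero k hk] using G.t_mono hk (Nat.zero_le i) hi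
  · simpa [G.t_last k hk] using G.t_mono hk hi le_rfl

theorem stepSize_nonneg {k : ℕ} (hk : k ≤ L) {n : ℕ} (hn : n < G.N k) : 0 ≤ G.stepSize k n :=
  sub_nonneg.2 (G.t_lt k hk n hn).le

theorem stepSize_le_maxStep {k : ℕ} (hk : k ≤ L) {n : ℕ} (hn : n < G.N k) :
    G.stepSize k n ≤ G.maxStep := by
  refine le_trans ?_ (le_ciSup (f := fun k : Fin (L + 1) => ⨆ n : Fin (G.N k), G.stepSize k n)
    (Set.finite_range _).bddAbove ⟨k, Nat.lt_succ_of_le hk⟩)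
  exact le_ciSup (f := fun n : Fin (G.N k) => G.stepSize k n) (Set.finite_range _).bddAbove ⟨n, hn⟩

theorem maxStep_nonneg : 0 ≤ G.maxStep :=
  Real.iSup_nonneg fun k => Real.iSup_nonneg fun n =>
    G.stepSize_nonneg (Nat.le_of_lt_succ k.2) n.2

/-- Reduces the main theorem, where `κ` has no sign, to `0 ≤ κ`. -/
theorem StencilRegular.abs {κ : ℝ} {G : RIDCMesh a b L} (h : G.StencilRegular κ) :
    G.StencilRegular |κ| := fun k hk n hn i hi j hj =>
  ⟨((h k hk n hn i hi j hj).1).trans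
    (mul_le_mul_of_nonneg_right (le_abs_self κ) G.maxStep_nonneg),
  fun p hp q hq hpq => ((h k hk n hn i hi j hj).2 p hp q hq hpq).trans
    (mul_le_mul_of_nonneg_right (le_abs_self κ) (abs_nonneg _))⟩

/-- A regular stencil consists of regular nodes around the step it belongs to. -/
theorem StencilRegular.exists_regularNodes {κ : ℝ} {G : RIDCMesh a b L}
    (h : G.StencilRegular κ) (hκ : 0 ≤ κ) {k n : ℕ} (hk : k < L) (hn : n < G.N (k + 1)) :
    ∃ M ≤ κ * G.maxStep, RegularNodes (G.stencil (k + 1) n) (G.t k) κ M ∧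
      ∀ x ∈ Set.Icc (G.t (k + 1) n) (G.t (k + 1) (n + 1)), ∀ j ∈ G.stencil (k + 1) n,
        |x - G.t k j| ≤ M := by
  set s := G.stencil (k + 1) n with hs
  have hcard : s.card = (k + 1) + 1 := G.stencil_card k hk n hn
  obtain ⟨p₀, hp₀, q₀, hq₀, hpq₀⟩ := Finset.one_lt_card.1 (show 1 < s.card by omega)
  obtain ⟨⟨p, q⟩, hpq, hmax⟩ := Finset.exists_max_image (s ×ˢ s)
    (fun z => |G.t k z.1 - G.t k z.2|) ⟨(p₀, q₀), Finset.mk_mem_product hp₀ hq₀⟩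
  obtain ⟨hp, hq⟩ := Finset.mem_product.1 hpq
  have hdiam : ∀ i ∈ s, ∀ j ∈ s, |G.t k i - G.t k j| ≤ |G.t k p - G.t k q| := fun i hi j hj =>
    hmax (i, j) (Finset.mk_mem_product hi hj)
  -- `M` is the actual diameter, since regularity compares separations with it and not with the
  -- maximal step.
  refine ⟨|G.t k p - G.t k q|, (h k hk n hn p hp q hq).1, ⟨?_, hκ, ?_, hdiam⟩, ?_⟩
  · refine lt_of_lt_of_le (abs_pos.2 (sub_ne_zero.2 ?_)) (hdiam p₀ hp₀ q₀ hq₀)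
    have hp' := G.stencil_le k hk n hn p₀ hp₀
    have hq' := G.stencil_le k hk n hn q₀ hq₀
    rcases lt_or_gt_of_ne hpq₀ with hlt | hlt
    · exact (G.t_strictMono hk.le hlt hq').ne
    · exact (G.t_strictMono hk.le hlt hp').ne'
  · exact (h k hk n hn p hp q hq).2
  · intro x hx j hj
    obtain ⟨i, hi, hi'⟩ := G.stencil_min k hk n hn
    obtain ⟨i', hi'', hi'''⟩ := G.stencil_max k hk n hn
    have h1 := (le_abs_self _).trans (hdiam i' hi'' j hj)
    have h2 := (le_abs_self _).trans (hdiam j hj i hi)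
    have h3 := hx.1
    have h4 := hx.2
    rw [abs_le]
    constructor <;> linarith

end Grid

/-! ### Stability: from local to accumulated errors. -/

section Error

variable {a b : ℝ} {L : ℕ} (G : RIDCMesh a b L) {E : Type*} [NormedAddCommGroup E]
  [NormedSpace ℝ E] (f : ℝ → E → E) (y : ℝ → E) (ya : E)

/-- The error at the node `n` of level `k`. -/
noncomputable def error (k n : ℕ) : E := y (G.t k n) - G.solution f ya k n

/-- The defect of one step of level `k` applied to the exact solution at the node `n`. -/
noncomputable def localError (k n : ℕ) : E :=
  y (G.t k (n + 1)) - G.stepMap f ya k n (y (G.t k n))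

/-- Bounds of order `k + 1` on the errors of level `k`, uniform over the grid: for the local error
per unit step, for the accumulated error, and for its increments. -/
structure ErrorBounds (k : ℕ) (r C : ℝ) : Prop where
  local_le : ∀ n < G.N k,
    ‖G.localError f y ya k n‖ ≤ C * G.maxStep ^ (k + 1) * G.stepSize k n
  error_le : ∀ n ≤ G.N k,
    ‖G.error f y ya k n‖ ≤ C * G.maxStep ^ (k + 1) * (G.t k n - a)
  error_le_radius : ∀ n ≤ G.N k, ‖G.error f y ya k n‖ ≤ r
  sub_le : ∀ i ≤ G.N k, ∀ j ≤ G.N k,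
    ‖G.error f y ya k i - G.error f y ya k j‖ ≤ C * G.maxStep ^ (k + 1) * |G.t k i - G.t k j|

theorem solution_eq_sub_error (k n : ℕ) :
    G.solution f ya k n = y (G.t k n) - G.error f y ya k n := by
  simp [error]

/-- The interpolation and quadrature sums do not involve the starting value and cancel. -/
theorem stepMap_sub_stepMap (k n : ℕ) (x x' : E) :
    G.stepMap f ya k n x - G.stepMap f ya k n x' =
      x - x' + G.stepSize k n • (f (G.t k n) x - f (G.t k n) x') := by
  cases k <;> simp only [stepMap, predictorStep, correctorStep, smul_sub] <;> abel

theorem error_succ (k n : ℕ) :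
    G.error f y ya k (n + 1) = G.error f y ya k n + (G.localError f y ya k n +
      G.stepSize k n • (f (G.t k n) (y (G.t k n)) -
        f (G.t k n) (y (G.t k n) - G.error f y ya k n))) := by
  have h := G.stepMap_sub_stepMap f ya k n (y (G.t k n)) (G.solution f ya k n)
  have h2 : G.error f y ya k (n + 1) = G.localError f y ya k n +
      (G.stepMap f ya k n (y (G.t k n)) - G.stepMap f ya k n (G.solution f ya k n)) := by
    simp [error, localError, G.solution_succ]
  rw [h2, h, ← solution_eq_sub_error, error]
  abel

variable {f y ya} {G}

/-- Stability: the accumulated error is controlled by the local errors, as long as these are small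
enough for the solution not to leave a tube on which `f` is Lipschitz. -/
theorem norm_error_le {k : ℕ} (hk : k ≤ L) (hya : y a = ya) {r Λ A : ℝ} (hΛ0 : 0 ≤ Λ) (hA : 0 ≤ A)
    (hr : 0 ≤ r)
    (hΛ : ∀ s ∈ Set.Icc a b, ∀ d d' : E, ‖d‖ ≤ r → ‖d'‖ ≤ r →
      ‖f s (y s - d) - f s (y s - d')‖ ≤ Λ * ‖d - d'‖)
    (hloc : ∀ n < G.N k, ‖G.localError f y ya k n‖ ≤ A * G.stepSize k n)
    (hAr : A * Real.exp (Λ * (b - a)) * (b - a) ≤ r) {n : ℕ} (hn : n ≤ G.N k) :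
    ‖G.error f y ya k n‖ ≤ A * Real.exp (Λ * (b - a)) * (G.t k n - a) := by
  have hweak : ∀ n ≤ G.N k, A * Real.exp (Λ * (G.t k n - a)) * (G.t k n - a) ≤
      A * Real.exp (Λ * (b - a)) * (G.t k n - a) := by
    intro n hn
    have h1 := G.t_mem_Icc hk hn
    have h2 : 0 ≤ G.t k n - a := sub_nonneg.2 h1.1
    gcongr
    exact h1.2
  -- The exponent must grow with the node for the induction to close; the uniform exponent only
  -- serves to keep the error inside the tube.
  suffices h : ‖G.error f y ya k n‖ ≤ A * Real.exp (Λ * (G.t k n - a)) * (G.t k n - a) from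
    h.trans (hweak n hn)
  induction n with
  | zero => simp [error, G.solution_zero, G.t_zero k hk, hya]
  | succ n ih =>
    have ih := ih (by omega)
    have hmem := G.t_mem_Icc hk (show n ≤ G.N k by omega)
    have hs0 : 0 ≤ G.t k n - a := sub_nonneg.2 hmem.1
    have hsb : G.t k n - a ≤ b - a := sub_le_sub_right hmem.2 a
    have hrad : ‖G.error f y ya k n‖ ≤ r := by
      refine (ih.trans (hweak n (by omega))).trans (le_trans ?_ hAr)
      gcongr
    have hh := G.stepSize_nonneg hk (show n < G.N k by omega)
    set h := G.stepSize k n with hdef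
    set σ := G.t k n - a with hσ
    have ht : G.t k (n + 1) - a = σ + h := by rw [hσ, hdef, stepSize]; ring
    have hf := hΛ _ hmem 0 (G.error f y ya k n) (by simpa using hr) hrad
    rw [sub_zero, zero_sub, norm_neg] at hf
    have hstep : ‖G.error f y ya k (n + 1)‖ ≤
        ‖G.error f y ya k n‖ + (A * h + h * (Λ * ‖G.error f y ya k n‖)) := by
      rw [error_succ]
      refine (norm_add_le _ _).trans ?_
      gcongr
      refine (norm_add_le _ _).trans (add_le_add (hloc n (by omega)) ?_)
      rw [norm_smul, Real.norm_of_nonneg hh]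
      gcongr
    rw [ht]
    have hexp : (1 + Λ * h) * Real.exp (Λ * σ) ≤ Real.exp (Λ * (σ + h)) := by
      rw [mul_add, add_comm (Λ * σ), Real.exp_add]
      gcongr
      linarith [Real.add_one_le_exp (Λ * h)]
    have hexp1 : 1 ≤ Real.exp (Λ * (σ + h)) := Real.one_le_exp (by positivity)
    calc _ ≤ _ := hstep
      _ = (1 + Λ * h) * ‖G.error f y ya k n‖ + A * h := by ring
      _ ≤ (1 + Λ * h) * (A * Real.exp (Λ * σ) * σ) + A * h * 1 := by rw [mul_one]; gcongr
      _ = A * σ * ((1 + Λ * h) * Real.exp (Λ * σ)) + A * h * 1 := by ring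
      _ ≤ A * σ * Real.exp (Λ * (σ + h)) + A * h * Real.exp (Λ * (σ + h)) := by gcongr
      _ = _ := by ring

theorem norm_error_sub_le {k : ℕ} (hk : k ≤ L) {r Λ A B : ℝ} (hΛ0 : 0 ≤ Λ) (hr : 0 ≤ r)
    (hΛ : ∀ s ∈ Set.Icc a b, ∀ d d' : E, ‖d‖ ≤ r → ‖d'‖ ≤ r →
      ‖f s (y s - d) - f s (y s - d')‖ ≤ Λ * ‖d - d'‖)
    (hloc : ∀ n < G.N k, ‖G.localError f y ya k n‖ ≤ A * G.stepSize k n)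
    (hB : ∀ n ≤ G.N k, ‖G.error f y ya k n‖ ≤ B) (hBr : B ≤ r) {i j : ℕ}
    (hi : i ≤ G.N k) (hj : j ≤ G.N k) :
    ‖G.error f y ya k i - G.error f y ya k j‖ ≤ (A + Λ * B) * |G.t k i - G.t k j| := by
  wlog hij : i ≤ j generalizing i j
  · rw [norm_sub_rev, abs_sub_comm]
    exact this hj hi (by omega)
  rw [norm_sub_rev, abs_sub_comm, abs_of_nonneg (sub_nonneg.2 (G.t_mono hk hij hj))]
  induction j, hij using Nat.le_induction with
  | base => simp
  | succ j hij ih =>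
    have ih := ih (by omega)
    have hmem := G.t_mem_Icc hk (show j ≤ G.N k by omega)
    have hh := G.stepSize_nonneg hk (show j < G.N k by omega)
    have hBj := hB j (by omega)
    have hf := hΛ _ hmem 0 (G.error f y ya k j) (by simpa using hr) (hBj.trans hBr)
    rw [sub_zero, zero_sub, norm_neg] at hf
    rw [error_succ, add_sub_right_comm]
    refine (norm_add_le _ _).trans ?_
    have h2 : ‖G.stepSize k j • (f (G.t k j) (y (G.t k j)) -
        f (G.t k j) (y (G.t k j) - G.error f y ya k j))‖ ≤ G.stepSize k j * (Λ * B) := by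
      rw [norm_smul, Real.norm_of_nonneg hh]
      gcongr
      exact hf.trans (by gcongr)
    refine (add_le_add ih ((norm_add_le _ _).trans (add_le_add (hloc j (by omega)) h2))).trans ?_
    rw [stepSize]
    apply le_of_eq
    ring

/-- Uniform bounds on the local errors of a level give uniform bounds on all errors. -/
theorem exists_errorBounds_of_local {k : ℕ} (hk : k ≤ L) (hab : a < b) (hya : y a = ya) {κ r Λ : ℝ}
    (hΛ0 : 0 ≤ Λ) (hr : 0 < r)
    (hΛ : ∀ s ∈ Set.Icc a b, ∀ d d' : E, ‖d‖ ≤ r → ‖d'‖ ≤ r →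
      ‖f s (y s - d) - f s (y s - d')‖ ≤ Λ * ‖d - d'‖) {A δ : ℝ} (hA : 0 ≤ A) (hδ : 0 < δ)
    (hloc : ∀ G : RIDCMesh a b L, G.StencilRegular κ → G.maxStep ≤ δ → ∀ n < G.N k,
      ‖G.localError f y ya k n‖ ≤ A * G.maxStep ^ (k + 1) * G.stepSize k n) :
    ∃ C δ' : ℝ, 0 ≤ C ∧ 0 < δ' ∧ ∀ G : RIDCMesh a b L, G.StencilRegular κ → G.maxStep ≤ δ' →
      G.ErrorBounds f y ya k r C := by
  have hba : 0 < b - a := sub_pos.2 hab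
  set e := Real.exp (Λ * (b - a)) with he
  have he0 : 1 ≤ e := Real.one_le_exp (by positivity)
  -- `A * e` covers the accumulated error; the second term is the Lipschitz contribution to its
  -- increments.
  set C := A * e + Λ * (A * e * (b - a)) with hC
  have hAC : A ≤ C := by
    have h1 : A ≤ A * e := le_mul_of_one_le_right hA he0
    have h2 : 0 ≤ Λ * (A * e * (b - a)) := by positivity
    linarith
  have hAeC : A * e ≤ C := by
    have h2 : 0 ≤ Λ * (A * e * (b - a)) := by positivity
    linarith
  -- The bound `1` gives `D ^ (k + 1) ≤ D`, and the quotient then keeps the error below `r`; the `+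
  -- 1` makes the denominator positive even if `A = 0`.
  refine ⟨C, min δ (min 1 (r / (A * e * (b - a) + 1))), hA.trans hAC, by positivity,
    fun G hG hδ' => ?_⟩
  obtain ⟨h1, h2, h3⟩ : G.maxStep ≤ δ ∧ G.maxStep ≤ 1 ∧
      G.maxStep ≤ r / (A * e * (b - a) + 1) := by simpa using hδ'
  have hD := G.maxStep_nonneg
  set D := G.maxStep with hDdef
  have hDk : 0 ≤ D ^ (k + 1) := by positivity
  have hl := hloc G hG h1
  have hsmall : A * D ^ (k + 1) * e * (b - a) ≤ r := by
    have h4 : D ^ (k + 1) ≤ D := pow_le_of_le_one hD h2 (by omega)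
    rw [le_div_iff₀ (by positivity)] at h3
    calc A * D ^ (k + 1) * e * (b - a) = A * e * (b - a) * D ^ (k + 1) := by ring
      _ ≤ A * e * (b - a) * D := by gcongr
      _ ≤ r := by linarith
  have herr : ∀ n ≤ G.N k, ‖G.error f y ya k n‖ ≤ A * D ^ (k + 1) * e * (G.t k n - a) :=
    fun n hn => norm_error_le hk hya hΛ0 (by positivity) hr.le hΛ hl hsmall hn
  have hsub0 : ∀ n ≤ G.N k, 0 ≤ G.t k n - a := fun n hn => sub_nonneg.2 (G.t_mem_Icc hk hn).1
  have herr' : ∀ n ≤ G.N k, ‖G.error f y ya k n‖ ≤ A * D ^ (k + 1) * e * (b - a) := by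
    intro n hn
    refine (herr n hn).trans ?_
    gcongr
    exact (G.t_mem_Icc hk hn).2
  refine ⟨fun n hn => (hl n hn).trans ?_, fun n hn => (herr n hn).trans ?_,
    fun n hn => (herr' n hn).trans hsmall, fun i hi j hj => ?_⟩
  · have := G.stepSize_nonneg hk hn
    gcongr
  · have := hsub0 n hn
    rw [mul_right_comm A]
    gcongr
  · refine (norm_error_sub_le hk hΛ0 hr.le hΛ hl herr' hsmall hi hj).trans ?_
    gcongr
    calc A * D ^ (k + 1) + Λ * (A * D ^ (k + 1) * e * (b - a))
        = (A + Λ * (A * e * (b - a))) * D ^ (k + 1) := by ring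
      _ ≤ C * D ^ (k + 1) := by
        gcongr
        rw [hC]
        gcongr
        exact le_mul_of_one_le_right hA he0

end Error

end RIDCMesh

namespace RIDCMesh

/-! ### Local errors of the predictor and the corrector. -/

section LocalError

variable {a b : ℝ} {L : ℕ} {G : RIDCMesh a b L} {E : Type*} [NormedAddCommGroup E]
  {f : ℝ → E → E} {y : ℝ → E} {ya : E}

theorem intervalIntegrable_rhs (hg : ContinuousOn (fun s => f s (y s)) (Set.Icc a b)) {u v : ℝ}
    (hu : a ≤ u) (huv : u ≤ v) (hv : v ≤ b) :
    IntervalIntegrable (fun s => f s (y s)) MeasureTheory.volume u v :=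
  (hg.mono (by rw [Set.uIcc_of_le huv]; exact Set.Icc_subset_Icc hu hv)).intervalIntegrable

variable [NormedSpace ℝ E]

/-- The interpolant, on the stencil of step `n` of level `k + 1`, of the right-hand side along the
discrete solution of level `k`. -/
noncomputable def interpolant (G : RIDCMesh a b L) (f : ℝ → E → E) (ya : E) (k n : ℕ) (s : ℝ) : E :=
  ∑ i ∈ G.stencil (k + 1) n, (Lagrange.basis (G.stencil (k + 1) n) (G.t k) i).eval s •
    f (G.t k i) (G.solution f ya k i)

variable [CompleteSpace E]

theorem integral_rhs_eq_sub (hy : ∀ s ∈ Set.Icc a b, HasDerivWithinAt y (f s (y s)) (Set.Icc a b) s)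
    (hg : ContinuousOn (fun s => f s (y s)) (Set.Icc a b)) {u v : ℝ}
    (hu : a ≤ u) (huv : u ≤ v) (hv : v ≤ b) : ∫ s in u..v, f s (y s) = y v - y u := by
  have hsub : Set.Icc u v ⊆ Set.Icc a b := Set.Icc_subset_Icc hu hv
  refine intervalIntegral.integral_eq_sub_of_hasDerivAt_of_le huv
    (fun s hs => ((hy s (hsub hs)).continuousWithinAt).mono hsub) (fun s hs => ?_)
    (intervalIntegrable_rhs hg hu huv hv)
  exact (hy s (hsub (Set.Ioo_subset_Icc_self hs))).hasDerivAt
    (Icc_mem_nhds (hu.trans_lt hs.1) (hs.2.trans_le hv))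

theorem localError_zero (hy : ∀ s ∈ Set.Icc a b, HasDerivWithinAt y (f s (y s)) (Set.Icc a b) s)
    (hg : ContinuousOn (fun s => f s (y s)) (Set.Icc a b)) {n : ℕ} (hn : n < G.N 0) :
    G.localError f y ya 0 n =
      ∫ s in (G.t 0 n)..(G.t 0 (n + 1)), (f s (y s) - f (G.t 0 n) (y (G.t 0 n))) := by
  have h1 := (G.t_mem_Icc (Nat.zero_le L) hn.le).1
  have h2 := (G.t_mem_Icc (Nat.zero_le L) (Nat.succ_le_of_lt hn)).2
  have h12 := (G.t_lt 0 (Nat.zero_le L) n hn).le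
  rw [intervalIntegral.integral_sub (intervalIntegrable_rhs hg h1 h12 h2) (by simp),
    integral_rhs_eq_sub hy hg h1 h12 h2, intervalIntegral.integral_const, localError, stepMap,
    predictorStep, stepSize]
  abel

/-- The quadrature weights integrate the interpolant exactly, and the Euler bracket is the integral
of a constant: the value of the residual at the left end of the step. -/
theorem localError_succ (hy : ∀ s ∈ Set.Icc a b, HasDerivWithinAt y (f s (y s)) (Set.Icc a b) s)
    (hg : ContinuousOn (fun s => f s (y s)) (Set.Icc a b)) {k n : ℕ} (hk : k < L)
    (hn : n < G.N (k + 1)) :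
    G.localError f y ya (k + 1) n =
      ∫ s in (G.t (k + 1) n)..(G.t (k + 1) (n + 1)),
        ((f s (y s) - G.interpolant f ya k n s) -
          (f (G.t (k + 1) n) (y (G.t (k + 1) n)) - G.interpolant f ya k n (G.t (k + 1) n))) := by
  have h1 := (G.t_mem_Icc (show k + 1 ≤ L from hk) hn.le).1
  have h2 := (G.t_mem_Icc (show k + 1 ≤ L from hk) (Nat.succ_le_of_lt hn)).2
  have h12 := (G.t_lt (k + 1) hk n hn).le
  have hgi := intervalIntegrable_rhs hg h1 h12 h2
  have hterm : ∀ i ∈ G.stencil (k + 1) n, IntervalIntegrable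
      (fun s => (Lagrange.basis (G.stencil (k + 1) n) (G.t k) i).eval s •
        f (G.t k i) (G.solution f ya k i)) MeasureTheory.volume
      (G.t (k + 1) n) (G.t (k + 1) (n + 1)) := fun i _ =>
    ((Polynomial.continuous _).smul continuous_const).intervalIntegrable _ _
  have hQi : IntervalIntegrable (G.interpolant f ya k n) MeasureTheory.volume
      (G.t (k + 1) n) (G.t (k + 1) (n + 1)) := by
    refine Continuous.intervalIntegrable (continuous_finsetSum _ fun i _ => ?_) _ _
    exact (Polynomial.continuous _).smul continuous_const
  have hQ : ∫ s in (G.t (k + 1) n)..(G.t (k + 1) (n + 1)), G.interpolant f ya k n s =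
      ∑ i ∈ G.stencil (k + 1) n, G.quadWeight k n i • f (G.t k i) (G.solution f ya k i) := by
    simp only [interpolant]
    rw [intervalIntegral.integral_finsetSum hterm]
    refine Finset.sum_congr rfl fun i _ => ?_
    rw [intervalIntegral.integral_smul_const, quadWeight]
  have hQ0 : ∑ i ∈ G.stencil (k + 1) n, G.interpWeight k n i • f (G.t k i) (G.solution f ya k i) =
      G.interpolant f ya k n (G.t (k + 1) n) := rfl
  rw [intervalIntegral.integral_sub (hgi.sub hQi) (by simp), intervalIntegral.integral_sub hgi hQi,
    integral_rhs_eq_sub hy hg h1 h12 h2, intervalIntegral.integral_const, hQ, localError, stepMap,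
    correctorStep, hQ0, stepSize]
  abel

theorem norm_localError_zero_le
    (hy : ∀ s ∈ Set.Icc a b, HasDerivWithinAt y (f s (y s)) (Set.Icc a b) s)
    (hg : ContinuousOn (fun s => f s (y s)) (Set.Icc a b)) {R : ℝ}
    (hR : ∀ s ∈ Set.Icc a b, ∀ s' ∈ Set.Icc a b, ‖f s (y s) - f s' (y s')‖ ≤ R * |s - s'|)
    (hR0 : 0 ≤ R) {n : ℕ} (hn : n < G.N 0) :
    ‖G.localError f y ya 0 n‖ ≤ R * G.maxStep ^ (0 + 1) * G.stepSize 0 n := by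
  have h12 := (G.t_lt 0 (Nat.zero_le L) n hn).le
  have hm := G.t_mem_Icc (Nat.zero_le L) hn.le
  have hm' := G.t_mem_Icc (Nat.zero_le L) (Nat.succ_le_of_lt hn)
  have hD := G.stepSize_le_maxStep (Nat.zero_le L) hn
  rw [localError_zero hy hg hn, stepSize, ← abs_of_nonneg (sub_nonneg.2 h12), zero_add, pow_one]
  refine intervalIntegral.norm_integral_le_of_norm_le_const fun s hs => ?_
  rw [Set.uIoc_of_le h12] at hs
  refine (hR s ⟨hm.1.trans hs.1.le, hs.2.trans hm'.2⟩ _ hm).trans ?_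
  gcongr
  rw [abs_of_nonneg (sub_nonneg.2 hs.1.le)]
  exact (sub_le_sub_right hs.2 _).trans hD

theorem norm_localError_succ_le (hab : a < b)
    (hy : ∀ s ∈ Set.Icc a b, HasDerivWithinAt y (f s (y s)) (Set.Icc a b) s) {k : ℕ} (hk : k < L)
    (hg : ContDiffOn ℝ ((k + 1 : ℕ) + 1) (fun s => f s (y s)) (Set.Icc a b)) {R : ℝ}
    (hR : ∀ s ∈ Set.Icc a b,
      ‖iteratedDerivWithin (k + 1 + 1) (fun s => f s (y s)) (Set.Icc a b) s‖ ≤ R)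
    {r Λ C₂ κ C : ℝ} (hΛ0 : 0 ≤ Λ) (hC₂0 : 0 ≤ C₂) (hκ : 0 ≤ κ) (hC0 : 0 ≤ C)
    (hΛ : ∀ s ∈ Set.Icc a b, ∀ d d' : E, ‖d‖ ≤ r → ‖d'‖ ≤ r →
      ‖f s (y s - d) - f s (y s - d')‖ ≤ Λ * ‖d - d'‖)
    (hC₂ : ∀ s ∈ Set.Icc a b, ∀ s' ∈ Set.Icc a b, ∀ d : E, ‖d‖ ≤ r →
      ‖(f s (y s) - f s (y s - d)) - (f s' (y s') - f s' (y s' - d))‖ ≤ C₂ * |s - s'| * ‖d‖)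
    (hG : G.StencilRegular κ) (hC : G.ErrorBounds f y ya k r C) {n : ℕ} (hn : n < G.N (k + 1)) :
    ‖G.localError f y ya (k + 1) n‖ ≤
      (2 * ((1 + ((k + 1 : ℕ) + 1) * κ ^ (k + 1)) * R * κ ^ (k + 1 + 1)) +
        ((k + 1 : ℕ) + 1) * (k + 1 : ℕ) * κ ^ (k + 1) * (C * (Λ + C₂ * (b - a)))) *
      G.maxStep ^ (k + 1 + 1) * G.stepSize (k + 1) n := by
  have hk1 : k + 1 ≤ L := hk
  have h12 := G.t_lt (k + 1) hk1 n hn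
  have hm := G.t_mem_Icc hk1 hn.le
  have hm' := G.t_mem_Icc hk1 (Nat.succ_le_of_lt hn)
  have hD0 := G.maxStep_nonneg
  have hba : 0 < b - a := sub_pos.2 hab
  have hR0 : 0 ≤ R := (norm_nonneg _).trans (hR _ hm)
  obtain ⟨M, hMκ, hreg, hx⟩ := hG.exists_regularNodes hκ hk hn
  have hstep := G.stepSize_le_maxStep hk1 hn
  set s₀ := G.stencil (k + 1) n with hs₀
  set D := G.maxStep with hD
  have hcard : s₀.card = (k + 1) + 1 := G.stencil_card k hk n hn
  have hle : ∀ i ∈ s₀, i ≤ G.N k := G.stencil_le k hk n hn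
  have hnode : ∀ i ∈ s₀, G.t k i ∈ Set.Icc a b := fun i hi => G.t_mem_Icc hk.le (hle i hi)
  obtain ⟨i₀, hi₀, hi₀'⟩ := G.stencil_min k hk n hn
  set g : ℝ → E := fun s => f s (y s) with hgdef
  set e : ℕ → E := fun i =>
    f (G.t k i) (y (G.t k i)) - f (G.t k i) (G.solution f ya k i) with he
  set B := C * (Λ + C₂ * (b - a)) * D ^ (k + 1) with hB
  have hB0 : 0 ≤ B := by positivity
  have helip : ∀ i ∈ s₀, ∀ j ∈ s₀, ‖e i - e j‖ ≤ B * |G.t k i - G.t k j| := by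
    intro i hi j hj
    have hei := hC.error_le_radius i (hle i hi)
    have hej := hC.error_le_radius j (hle j hj)
    have h1 := hΛ _ (hnode i hi) _ _ hej hei
    have h2 := hC₂ _ (hnode i hi) _ (hnode j hj) _ hej
    have h3 := hC.sub_le j (hle j hj) i (hle i hi)
    have h4 : ‖G.error f y ya k j‖ ≤ C * D ^ (k + 1) * (b - a) := by
      refine (hC.error_le j (hle j hj)).trans ?_
      gcongr
      exact (hnode j hj).2
    rw [abs_sub_comm] at h3
    -- First the error changes at a fixed node, which uses the increment bound of level `k`; then
    -- the node changes at a fixed error, which uses the mixed difference.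
    have key : e i - e j =
        (f (G.t k i) (y (G.t k i) - G.error f y ya k j) -
          f (G.t k i) (y (G.t k i) - G.error f y ya k i)) +
        ((f (G.t k i) (y (G.t k i)) - f (G.t k i) (y (G.t k i) - G.error f y ya k j)) -
          (f (G.t k j) (y (G.t k j)) - f (G.t k j) (y (G.t k j) - G.error f y ya k j))) := by
      simp only [he, G.solution_eq_sub_error f y ya]
      abel
    rw [key]
    calc _ ≤ _ := norm_add_le _ _
      _ ≤ Λ * (C * D ^ (k + 1) * |G.t k i - G.t k j|) +
          C₂ * |G.t k i - G.t k j| * (C * D ^ (k + 1) * (b - a)) :=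
        add_le_add (h1.trans (by gcongr)) (h2.trans (by gcongr))
      _ = _ := by rw [hB]; ring
  have hsplit : ∀ s, f s (y s) - G.interpolant f ya k n s =
      (g s - ∑ i ∈ s₀, (Lagrange.basis s₀ (G.t k) i).eval s • g (G.t k i)) +
      ∑ i ∈ s₀, (Lagrange.basis s₀ (G.t k) i).eval s • e i := by
    intro s
    simp only [interpolant, he, hgdef, smul_sub, Finset.sum_sub_distrib, ← hs₀]
    abel
  have hinterp : ∀ s ∈ Set.Icc (G.t (k + 1) n) (G.t (k + 1) (n + 1)),
      ‖g s - ∑ i ∈ s₀, (Lagrange.basis s₀ (G.t k) i).eval s • g (G.t k i)‖ ≤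
        (1 + ((k + 1 : ℕ) + 1) * κ ^ (k + 1)) * R * (κ * D) ^ (k + 1 + 1) := by
    intro s hs
    refine (hreg.norm_sub_interp_le hcard hab hg hR hnode ⟨hm.1.trans hs.1, hs.2.trans hm'.2⟩
      (hx s hs) ⟨i₀, hi₀, hi₀'.trans hs.1⟩
      ⟨i₀, hi₀, hi₀'.trans_lt (h12.trans_le hm'.2)⟩).trans ?_
    have := hreg.pos
    gcongr
  rw [localError_succ hy hg.continuousOn hk hn, stepSize, ← abs_of_pos (sub_pos.2 h12)]
  refine intervalIntegral.norm_integral_le_of_norm_le_const fun s hs => ?_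
  rw [Set.uIoc_of_le h12.le] at hs
  have hs' : s ∈ Set.Icc (G.t (k + 1) n) (G.t (k + 1) (n + 1)) := ⟨hs.1.le, hs.2⟩
  have hl : G.t (k + 1) n ∈ Set.Icc (G.t (k + 1) n) (G.t (k + 1) (n + 1)) :=
    Set.left_mem_Icc.2 h12.le
  rw [hsplit, hsplit, add_sub_add_comm]
  have hlip := hreg.norm_interp_sub_le hcard (hx s hs') (hx _ hl) hB0 helip
  have hsD : |s - G.t (k + 1) n| ≤ D := by
    rw [abs_of_nonneg (sub_nonneg.2 hs.1.le)]
    exact (sub_le_sub_right hs.2 _).trans hstep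
  calc _ ≤ _ := norm_add_le _ _
    _ ≤ ((1 + ((k + 1 : ℕ) + 1) * κ ^ (k + 1)) * R * (κ * D) ^ (k + 1 + 1) +
          (1 + ((k + 1 : ℕ) + 1) * κ ^ (k + 1)) * R * (κ * D) ^ (k + 1 + 1)) +
        ((k + 1 : ℕ) + 1) * (k + 1 : ℕ) * κ ^ (k + 1) * B * D := by
      refine add_le_add ((norm_sub_le _ _).trans (add_le_add (hinterp s hs') (hinterp _ hl)))
        (hlip.trans ?_)
      gcongr
    _ = _ := by rw [hB, mul_pow]; ring

end LocalError

/-- Every level `k` of the method satisfies error bounds of order `k + 1`. -/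
theorem exists_errorBounds {a b : ℝ} {L : ℕ} {E : Type*} [NormedAddCommGroup E] [NormedSpace ℝ E]
    [ProperSpace E] {f : ℝ → E → E} {y : ℝ → E} {ya : E} {U : Set (ℝ × E)} (hab : a < b)
    (hU : IsOpen U) (hf : ContDiffOn ℝ ((L + 1 : ℕ) : WithTop ℕ∞) (Function.uncurry f) U)
    (hyU : ∀ s ∈ Set.Icc a b, (s, y s) ∈ U)
    (hy : ∀ s ∈ Set.Icc a b, HasDerivWithinAt y (f s (y s)) (Set.Icc a b) s)
    (hya : y a = ya) {κ : ℝ} (hκ : 0 ≤ κ) {r : ℝ} (hr0 : 0 < r)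
    (hr : ∀ s ∈ Set.Icc a b, ∀ d : E, ‖d‖ ≤ r → (s, y s - d) ∈ U) :
    ∀ k ≤ L, ∃ C δ : ℝ, 0 ≤ C ∧ 0 < δ ∧ ∀ G : RIDCMesh a b L, G.StencilRegular κ →
      G.maxStep ≤ δ → G.ErrorBounds f y ya k r C := by
  have hyc : ContinuousOn y (Set.Icc a b) := fun s hs => (hy s hs).continuousWithinAt
  have hud := uniqueDiffOn_Icc hab
  have hg := contDiffOn_rhs_of_hasDerivWithinAt hab hf hyU hy
  obtain ⟨Λ, hΛ0, hΛ⟩ := exists_lipschitz_on_tube hU (hf.of_le (by norm_cast; omega)) hyc hr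
  have hRk : ∀ k ≤ L, ∃ R : ℝ, ∀ s ∈ Set.Icc a b,
      ‖iteratedDerivWithin (k + 1) (fun s => f s (y s)) (Set.Icc a b) s‖ ≤ R := fun k hk =>
    isCompact_Icc.exists_bound_of_continuousOn
      (hg.continuousOn_iteratedDerivWithin (by norm_cast; omega) hud)
  intro k
  induction k with
  | zero =>
    intro _
    obtain ⟨R, hR⟩ := hRk 0 (Nat.zero_le L)
    have hR0 : 0 ≤ R := (norm_nonneg _).trans (hR a (Set.left_mem_Icc.2 hab.le))
    refine exists_errorBounds_of_local (Nat.zero_le L) hab hya hΛ0 hr0 hΛ hR0 one_pos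
      fun G _ _ n hn => norm_localError_zero_le hy hg.continuousOn (fun s hs s' hs' => ?_) hR0 hn
    refine (convex_Icc a b).norm_image_sub_le_of_norm_derivWithin_le (𝕜 := ℝ)
      (f := fun s => f s (y s)) (hg.differentiableOn (by simp))
      (fun x hx => ?_) hs' hs
    simpa [iteratedDerivWithin_one] using hR x hx
  | succ k ih =>
    intro hk
    obtain ⟨C, δ, hC0, hδ, hC⟩ := ih (by omega)
    obtain ⟨R, hR⟩ := hRk (k + 1) hk
    have hR0 : 0 ≤ R := (norm_nonneg _).trans (hR a (Set.left_mem_Icc.2 hab.le))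
    -- A correction level exists only if `1 ≤ L`, so `f` is of class `C^2` here.
    obtain ⟨C₂, hC₂0, hC₂⟩ := exists_lipschitz_increment_on_tube hU
      (hf.of_le (by norm_cast; omega)) hy hr0.le hr
    have hba : 0 < b - a := sub_pos.2 hab
    refine exists_errorBounds_of_local hk hab hya hΛ0 hr0 hΛ ?_ hδ fun G hG hGδ n hn =>
      norm_localError_succ_le hab hy (by omega) (hg.of_le (by norm_cast; omega)) hR hΛ0 hC₂0 hκ hC0
        hΛ hC₂ hG (hC G hG hGδ) hn
    positivity

end RIDCMesh

theorem mainTheorem1 {m : ℕ} (ℓ : ℕ) (a b : ℝ) (hab : a < b)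
    (f : ℝ → EuclideanSpace ℝ (Fin m) → EuclideanSpace ℝ (Fin m))
    (y : ℝ → EuclideanSpace ℝ (Fin m)) (ya : EuclideanSpace ℝ (Fin m))
    (U : Set (ℝ × EuclideanSpace ℝ (Fin m))) (hU : IsOpen U)
    (hf : ContDiffOn ℝ ((ℓ + 1 : ℕ) : WithTop ℕ∞) (Function.uncurry f) U)
    (hyU : ∀ s ∈ Set.Icc a b, (s, y s) ∈ U)
    (hy : ∀ s ∈ Set.Icc a b, HasDerivWithinAt y (f s (y s)) (Set.Icc a b) s)
    (hya : y a = ya) (κ : ℝ) :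
    ∃ C : ℝ, ∃ δ : ℝ, 0 < δ ∧
      ∀ G : RIDCMesh a b ℓ, G.StencilRegular κ → G.maxStep ≤ δ →
        (∀ n < G.N ℓ,
          ‖y (G.t ℓ (n + 1)) - G.stepMap f ya ℓ n (y (G.t ℓ n))‖ ≤ C * G.maxStep ^ (ℓ + 2)) ∧
        (∀ n ≤ G.N ℓ,
          ‖y (G.t ℓ n) - G.solution f ya ℓ n‖ ≤
            C * (G.t ℓ n - a) * G.maxStep ^ (ℓ + 1)) := by
  obtain ⟨r, hr0, hr⟩ := exists_tube_subset hU (fun s hs => (hy s hs).continuousWithinAt) hyU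
  obtain ⟨C, δ, hC0, hδ, h⟩ := RIDCMesh.exists_errorBounds hab hU hf hyU hy hya (abs_nonneg κ)
    hr0 hr ℓ le_rfl
  refine ⟨C, δ, hδ, fun G hG hGδ => ⟨fun n hn => ?_, fun n hn => ?_⟩⟩
  · refine ((h G hG.abs hGδ).local_le n hn).trans ?_
    have hD := G.maxStep_nonneg
    rw [pow_succ _ (ℓ + 1), ← mul_assoc]
    gcongr
    exact G.stepSize_le_maxStep le_rfl hn
  · rw [mul_right_comm]
    exact (h G hG.abs hGδ).error_le n hn
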